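/- **Model.** Fix $\rho\in(0,1]$, noise level $N_0W>0$, received powers $P_j>0$ ($1\le j\le J$), and service requirements $S_l=-\ln P_{e,l}+\rho\ln M_l>0$ ($1\le l\le L$), where $P_{e,l}\in(0,1]$ is a tolerable error probability and $M_l\ge 1$ an integer alphabet size. A schedule is $s=(s_{lj})\in\mathbb Z_+^{LJ}$; let $\mathcal S_K=\{s:\sum_{l,j}s_{lj}\le K\}$. Under the schedule $s$ every transmitted message of received power class $j$ gets in one slot the service quantum $$\phi_j(s)=\rho\ln\Bigl(1+\frac{P_j}{(1+\rho)\,(N_0W+\sum_{l',j'}s_{l'j'}P_{j'}-P_j)}\Bigr)\ \text{ if }\sum_l s_{lj}>0,\qquad \phi_j(s)=0\ \text{ otherwise.}$$ A state $\alpha$ of the system is the finite list of the messages present, each described by its residual service requirement $x\in(0,S_l]$, its class $(l,j)$, and possibly a label assigned on arrival. A stationary scheduling policy with at most $K$ simultaneous transmissions chooses in each slot a (possibly random) set of at most $K$ messages of the current state, with a law that depends on the current state only. If $s$ is the schedule so realized, the residual requirement of each chosen message of power class $j$ decreases by $\phi_j(s)$, and messages with residual requirement $\le 0$ leave. At the end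 of the slot a batch of new messages arrives, independent of the past and identically distributed over the slots, each new class-$(l,j)$ message having residual requirement $S_l$. The numbers $A_{lj}$ of class-$(l,j)$ messages in a batch are independent over $(l,j)$ with finite second moments; $\mathbb EA=(\mathbb EA_{lj})$. Let $\{X_n\}$ be the resulting Markov chain of states. **Theorem.** Suppose that, for the given arrival law and the given stationary policy with at most $K$ simultaneous transmissions, the Markov chain $\{X_n\}$ (on a nonempty closed set $\mathcal X$ of states) is positive recurrent, i.e. from each state of $\mathcal X$ it returns to that state almost surely and in finite mean time, and that the number of messages in the system has finite stationary mean. Then $\mathbb EA\in\mathcal R_{out}$, where $$\mathcal R_{out}=\bigcup_{\pi}\Bigl\{\beta\in\mathbb R_+^{LJ}:\ \beta_{lj}\le\sum_{s\in\mathcal S_K:\,s_{lj}>0}\pi(s)\,\frac{s_{lj}\,\phi_j(s)}{S_l}\ \text{ for all } l,j\Bigr\},$$ the union being over all probability measures $\pi$ on $\mathcal S_K$. -/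

import Mathlib

open scoped ENNReal

namespace ScheduledAccess

/-! ### Markov chains with countably supported transition laws -/

section MarkovChain

variable {S : Type*}

open Classical in
/-- `avoid κ α n y` is the probability, for the chain `X` with transition law `κ` and `X 0 = α`,
that `X n = y` and `X m ≠ α` for all `1 ≤ m ≤ n`. -/
noncomputable def avoid (κ : S → PMF S) (α : S) : ℕ → S → ℝ≥0∞
  | 0, y => if y = α then 1 else 0
  | n + 1, y => if y = α then 0 else ∑' z, avoid κ α n z * κ z y

/-- The probability that the chain started at `α` returns to `α` for the first time
at time `n + 1`. -/
noncomputable def firstReturn (κ : S → PMF S) (α : S) (n : ℕ) : ℝ≥0∞ :=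
  ∑' z, avoid κ α n z * κ z α

/-- The state `α` is positive recurrent: the chain started at `α` returns to `α` almost surely,
and the mean return time is finite. -/
def IsPositiveRecurrentState (κ : S → PMF S) (α : S) : Prop :=
  ∑' n, firstReturn κ α n = 1 ∧ ∑' n, ((n + 1 : ℕ) : ℝ≥0∞) * firstReturn κ α n < ∞

/-- `𝒳` is closed (absorbing): from a state of `𝒳` the chain moves within `𝒳`. -/
def IsClosedSet (κ : S → PMF S) (𝒳 : Set S) : Prop :=
  ∀ α ∈ 𝒳, (κ α).support ⊆ 𝒳

/-- The chain with transition law `κ` and (nonempty) state space `𝒳` is positive recurrent. -/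
def IsPositiveRecurrent (κ : S → PMF S) (𝒳 : Set S) : Prop :=
  𝒳.Nonempty ∧ IsClosedSet κ 𝒳 ∧ ∀ α ∈ 𝒳, IsPositiveRecurrentState κ α

/-- `μ` is a stationary distribution of the chain with transition law `κ` and state space `𝒳`. -/
def IsStationary (κ : S → PMF S) (𝒳 : Set S) (μ : PMF S) : Prop :=
  μ.support ⊆ 𝒳 ∧ μ.bind κ = μ

/-- The quantity `c` has finite mean in stationarity. -/
def HasFiniteStationaryMean (κ : S → PMF S) (𝒳 : Set S) (c : S → ℕ) : Prop :=
  ∀ μ : PMF S, IsStationary κ 𝒳 μ → ∑' α, μ α * (c α : ℝ≥0∞) < ∞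

end MarkovChain

/-! ### Channel, service requirements and service quanta -/

/-- Physical parameters, with `L` service requirement classes and `J` received power classes. -/
structure Channel (L J : ℕ) where
  /-- parameter of the random coding bound -/
  ρ : ℝ
  ρ_pos : 0 < ρ
  ρ_le_one : ρ ≤ 1
  /-- noise power spectral density -/
  N₀ : ℝ
  N₀_pos : 0 < N₀
  /-- bandwidth -/
  W : ℝ
  W_pos : 0 < W
  /-- received powers -/
  P : Fin J → ℝ
  P_pos : ∀ j, 0 < P j
  /-- tolerable error probabilities -/
  Pe : Fin L → ℝ
  Pe_pos : ∀ l, 0 < Pe l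
  Pe_le_one : ∀ l, Pe l ≤ 1
  /-- message alphabet sizes -/
  M : Fin L → ℕ
  M_pos : ∀ l, 1 ≤ M l
  /-- the service requirements are positive -/
  req_pos : ∀ l, 0 < -Real.log (Pe l) + ρ * Real.log (M l)

/-- A schedule: `s l j` messages of class `(l, j)` are transmitted. -/
abbrev Schedule (L J : ℕ) := Fin L → Fin J → ℕ

/-- The finite set of schedules with at most `K` transmissions. -/
def schedules (L J K : ℕ) : Finset (Schedule L J) :=
  (Fintype.piFinset fun _ => Fintype.piFinset fun _ => Finset.range (K + 1)).filter
    fun s => ∑ l, ∑ j, s l j ≤ K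

theorem mem_schedules {L J K : ℕ} {s : Schedule L J} :
    s ∈ schedules L J K ↔ ∑ l, ∑ j, s l j ≤ K := by
  simp only [schedules, Finset.mem_filter, Fintype.mem_piFinset, Finset.mem_range,
    and_iff_right_iff_imp]
  intro h l j
  have h1 : s l j ≤ ∑ j, s l j :=
    Finset.single_le_sum (f := fun j => s l j) (fun _ _ => Nat.zero_le _) (Finset.mem_univ j)
  have h2 : ∑ j, s l j ≤ ∑ l, ∑ j, s l j :=
    Finset.single_le_sum (f := fun l => ∑ j, s l j) (fun _ _ => Nat.zero_le _) (Finset.mem_univ l)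
  omega

namespace Channel

variable {L J : ℕ} (ch : Channel L J)

/-- The service requirement `S_l = - ln P_{e,l} + ρ ln M_l`. -/
noncomputable def req (l : Fin L) : ℝ :=
  -Real.log (ch.Pe l) + ch.ρ * Real.log (ch.M l)

/-- The random coding exponent `E₀(ρ, p, v)` for received power `p` and effective noise
variance `v`. -/
noncomputable def E₀ (p v : ℝ) : ℝ :=
  ch.ρ * Real.log (1 + p / ((1 + ch.ρ) * v))

/-- The service quantum `φ_j(s)` received in one slot by each transmitted message of received
power class `j` when `s` is the schedule; it is `0` if `s` has no message of power class `j`.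
The effective noise is the thermal noise plus the received powers of all other transmissions. -/
noncomputable def φ (j : Fin J) (s : Schedule L J) : ℝ :=
  if 0 < ∑ l, s l j then
    ch.E₀ (ch.P j) (ch.N₀ * ch.W + (∑ l', ∑ j', (s l' j' : ℝ) * ch.P j' - ch.P j))
  else 0

/-- `Ψ_{lj} = ∑_{s ∈ S_K, s_{lj} > 0} π(s) s_{lj} φ_j(s) / S_l`. -/
noncomputable def Ψ (K : ℕ) (π : Schedule L J → ℝ) (l : Fin L) (j : Fin J) : ℝ :=
  ∑ s ∈ (schedules L J K).filter (fun s => 0 < s l j),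
    π s * ((s l j : ℝ) * ch.φ j s / ch.req l)

/-- Probability measures on the set of schedules with at most `K` transmissions. -/
def scheduleMeasures (L J K : ℕ) : Set (Schedule L J → ℝ) :=
  {π | (∀ s ∈ schedules L J K, 0 ≤ π s) ∧ ∑ s ∈ schedules L J K, π s = 1}

/-- The outer region: the union over probability measures `π` on `S_K` of the sets of
nonnegative `β` with `β_{lj} ≤ Ψ_{lj}` for all `l`, `j`. -/
def outerRegion (K : ℕ) : Set (Fin L → Fin J → ℝ) :=
  ⋃ π ∈ scheduleMeasures L J K, {β | ∀ l j, 0 ≤ β l j ∧ β l j ≤ ch.Ψ K π l j}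

end Channel

/-! ### Messages, arrivals, policies and the Markov chain -/

/-- A message in the system: residual service requirement, service requirement class, received
power class, and a label assigned on arrival. The label may be used by the scheduler
(for instance, the schedule which the message has been assigned to); with `Z = Unit` there
are no labels. -/
structure Message (L J : ℕ) (Z : Type*) where
  residual : ℝ
  l : Fin L
  j : Fin J
  label : Z

/-- A state: the finite sequence of the messages present in the system. -/
abbrev State (L J : ℕ) (Z : Type*) := List (Message L J Z)

/-- The states in which each message has residual requirement in `(0, S_l]`. -/
def validStates {L J : ℕ} (ch : Channel L J) (Z : Type*) : Set (State L J Z) :=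
  {α | ∀ m ∈ α, 0 < m.residual ∧ m.residual ≤ ch.req m.l}

/-- The number of messages of class `(l, j)` in a batch of (classified, labelled) arrivals. -/
def batchCount {L J : ℕ} {Z : Type*} (b : List (Fin L × Fin J × Z)) (l : Fin L) (j : Fin J) : ℕ :=
  b.countP fun c => decide (c.1 = l ∧ c.2.1 = j)

/-- The law of the batch of messages arriving in a slot. The numbers `A_{lj}` of arrivals of the
classes are independent with probability mass functions `p l j`, which have finite second (hence
first) moments. The labels, and the order in which the messages are listed, are arbitrary. -/
structure Arrivals (L J : ℕ) (Z : Type*) where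
  batch : PMF (List (Fin L × Fin J × Z))
  p : Fin L → Fin J → PMF ℕ
  law_counts : ∀ n : Fin L → Fin J → ℕ, (batch.map batchCount) n = ∏ l, ∏ j, p l j (n l j)
  second_moment : ∀ l j, ∑' k : ℕ, p l j k * (k : ℝ≥0∞) ^ 2 < ∞

/-- The arrival rate vector `𝔼A = (𝔼A_{lj})` (mean number of arrivals per slot). -/
noncomputable def Arrivals.mean {L J : ℕ} {Z : Type*} (A : Arrivals L J Z)
    (l : Fin L) (j : Fin J) : ℝ :=
  ∑' k : ℕ, (p A l j k).toReal * (k : ℝ)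

/-- A stationary, possibly randomized, scheduling policy with at most `K` simultaneous
transmissions: in state `α` a random set of messages (that is, of positions in `α`), with law
depending on `α` only, is chosen for transmission. -/
structure Policy (L J : ℕ) (Z : Type*) (K : ℕ) where
  choose : (α : State L J Z) → PMF (Finset (Fin α.length))
  card_le : ∀ α, ∀ T ∈ (choose α).support, T.card ≤ K

section Dynamics

variable {L J : ℕ} {Z : Type*}

/-- The schedule realized in state `α` by transmitting the messages at the positions in `T`. -/
def scheduleOf (α : State L J Z) (T : Finset (Fin α.length)) : Schedule L J :=
  fun l j => (T.filter fun k => (α.get k).l = l ∧ (α.get k).j = j).card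

open Classical in
/-- One slot of service: each transmitted message receives its quantum, and the messages whose
service is complete leave. -/
noncomputable def serve (ch : Channel L J) (α : State L J Z) (T : Finset (Fin α.length)) :
    State L J Z :=
  ((List.finRange α.length).map fun k =>
    { α.get k with
      residual := (α.get k).residual -
        if k ∈ T then ch.φ (α.get k).j (scheduleOf α T) else 0 }).filter
    fun m => 0 < m.residual

/-- A newly arrived message has its full service requirement. -/
noncomputable def newMessage (ch : Channel L J) (c : Fin L × Fin J × Z) : Message L J Z where
  residual := ch.req c.1
  l := c.1
  j := c.2.1
  label := c.2.2

/-- The transition law of the Markov chain: the policy chooses the transmitted messages, these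
are served, and an independent batch of arrivals joins at the end of the slot. -/
noncomputable def transition (ch : Channel L J) (A : Arrivals L J Z) {K : ℕ}
    (ω : Policy L J Z K) (α : State L J Z) : PMF (State L J Z) :=
  (ω.choose α).bind fun T =>
    A.batch.map fun b => serve ch α T ++ b.map (newMessage ch)

end Dynamics

end ScheduledAccess

/-! The proof is a conservation law for unfinished work. For each class `(l, j)`, let the work of a
state be the sum of the residual requirements of its messages of that class. In one slot arrivals
add `S_l · 𝔼A_{lj}` on average, while service removes at most `s_{lj} φ_j(s)`; it may remove less,
since the last quantum of a message can exceed its residual (`work_le_work_serve_add`). Under a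
stationary law the mean work is the same before and after the slot, and it is finite because it is
at most `S_l` times the mean number of messages. Cancelling it leaves `S_l · 𝔼A_{lj} ≤ 𝔼[s_{lj}
φ_j(s)]` (`IsStationary.req_mul_mean_le`), so the law of the realized schedule in stationarity
serves as `π`. A stationary law is obtained by normalizing the mean occupation of an excursion from
a recurrent state (`IsPositiveRecurrent.exists_isStationary`). -/

namespace ScheduledAccess

/-! ### Means of `ℝ≥0∞`-valued functions under a `PMF` -/

section Expectation

variable {S T : Type*}

/-- The mean of a nonnegative function under a probability mass function. -/
noncomputable def expect (p : PMF S) (f : S → ℝ≥0∞) : ℝ≥0∞ := ∑' a, p a * f a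

theorem expect_bind (p : PMF S) (q : S → PMF T) (f : T → ℝ≥0∞) :
    expect (p.bind q) f = expect p fun a => expect (q a) f := by
  simp only [expect, PMF.bind_apply, ← ENNReal.tsum_mul_right, ← ENNReal.tsum_mul_left]
  rw [ENNReal.tsum_comm]
  simp only [mul_assoc]

theorem expect_pure (a : S) (f : S → ℝ≥0∞) : expect (PMF.pure a) f = f a := by
  classical
  rw [expect, tsum_eq_single a]
  · simp
  · intro b hb
    simp [hb]

theorem expect_map (p : PMF S) (g : S → T) (f : T → ℝ≥0∞) :
    expect (p.map g) f = expect p fun a => f (g a) := by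
  simp only [PMF.map, expect_bind, Function.comp_apply, expect_pure]

theorem expect_const (p : PMF S) (c : ℝ≥0∞) : expect p (fun _ => c) = c := by
  rw [expect, ENNReal.tsum_mul_right, PMF.tsum_coe, one_mul]

theorem expect_add (p : PMF S) (f g : S → ℝ≥0∞) :
    expect p (fun a => f a + g a) = expect p f + expect p g := by
  simp only [expect, mul_add, ENNReal.tsum_add]

theorem expect_const_mul (p : PMF S) (c : ℝ≥0∞) (f : S → ℝ≥0∞) :
    expect p (fun a => c * f a) = c * expect p f := by
  simp only [expect, mul_left_comm _ c, ENNReal.tsum_mul_left]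

theorem expect_mono (p : PMF S) {f g : S → ℝ≥0∞} (h : ∀ a ∈ p.support, f a ≤ g a) :
    expect p f ≤ expect p g := by
  refine ENNReal.tsum_le_tsum fun a => ?_
  by_cases ha : p a = 0
  · simp [ha]
  · exact mul_le_mul_right (h a ((p.mem_support_iff a).2 ha)) _

end Expectation

/-! ### The stationary law of a positive recurrent chain -/

section Stationary

variable {S : Type*} {κ : S → PMF S}

/-- The next step of a path that has not yet returned either hits `α`, which is a first return, or
prolongs the excursion. -/
theorem tsum_avoid_succ (κ : S → PMF S) (α : S) (n : ℕ) :
    ∑' y, avoid κ α n y = ∑' y, avoid κ α (n + 1) y + firstReturn κ α n := by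
  classical
  have h1 : ∑' y, avoid κ α n y = ∑' y, ∑' z, avoid κ α n z * κ z y := by
    rw [ENNReal.tsum_comm]
    simp only [ENNReal.tsum_mul_left, PMF.tsum_coe, mul_one]
  have h2 : ∀ y, ∑' z, avoid κ α n z * κ z y =
      avoid κ α (n + 1) y + if y = α then firstReturn κ α n else 0 := by
    intro y
    by_cases h : y = α
    · simp [avoid, h, firstReturn]
    · simp [avoid, h]
  rw [h1]
  simp only [h2, ENNReal.tsum_add, tsum_ite_eq]

theorem tsum_avoid_zero (κ : S → PMF S) (α : S) : ∑' y, avoid κ α 0 y = 1 := by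
  classical
  simp [avoid]

/-- The probability of no return up to time `n` is the tail of the law of the return time. -/
theorem tsum_avoid_eq_tail {α : S} (h : ∑' n, firstReturn κ α n = 1) (n : ℕ) :
    ∑' y, avoid κ α n y = ∑' k, firstReturn κ α (k + n) := by
  induction n with
  | zero => simpa [tsum_avoid_zero] using h.symm
  | succ n ih =>
    have hfin : firstReturn κ α n ≠ ∞ :=
      ne_top_of_le_ne_top (h ▸ ENNReal.one_ne_top) (ENNReal.le_tsum n)
    rw [tsum_avoid_succ,
      tsum_eq_zero_add' (f := fun k => firstReturn κ α (k + n)) ENNReal.summable, zero_add,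
      add_comm, ENNReal.add_right_inj hfin] at ih
    rw [ih]
    exact tsum_congr fun k => by rw [add_right_comm, add_assoc]

/-- The mean number of visits before the first return to `α`. -/
noncomputable def occupation (κ : S → PMF S) (α y : S) : ℝ≥0∞ := ∑' n, avoid κ α n y

/-- After exchanging the sums, `f m` is counted once for each `n ≤ m`. Applied to the first-return
law, this turns tail probabilities into the mean return time. -/
theorem tsum_tail (f : ℕ → ℝ≥0∞) :
    ∑' n, ∑' k, f (k + n) = ∑' m, ((m + 1 : ℕ) : ℝ≥0∞) * f m := by
  classical
  have h : ∀ n, ∑' k, f (k + n) = ∑' m, if n ≤ m then f m else 0 := by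
    intro n
    rw [← ENNReal.summable.sum_add_tsum_nat_add' (f := fun m => if n ≤ m then f m else 0) (k := n)]
    rw [Finset.sum_eq_zero]
    · simp
    · intro i hi
      simp [Finset.mem_range.1 hi]
  simp only [h]
  rw [ENNReal.tsum_comm]
  refine tsum_congr fun m => ?_
  rw [tsum_eq_sum (s := Finset.range (m + 1))]
  · rw [Finset.sum_congr rfl (g := fun _ => f m)]
    · simp
    · intro n hn
      simp [Nat.lt_succ_iff.1 (Finset.mem_range.1 hn)]
  · intro n hn
    simp only [Finset.mem_range] at hn
    exact if_neg (by omega)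

theorem tsum_occupation {α : S} (h : ∑' n, firstReturn κ α n = 1) :
    ∑' y, occupation κ α y = ∑' n, ((n + 1 : ℕ) : ℝ≥0∞) * firstReturn κ α n := by
  simp only [occupation]
  rw [ENNReal.tsum_comm, ← tsum_tail]
  exact tsum_congr (tsum_avoid_eq_tail h)

theorem occupation_self (κ : S → PMF S) (α : S) : occupation κ α α = 1 := by
  rw [occupation, tsum_eq_single 0]
  · simp [avoid]
  · intro n hn
    obtain ⟨n, rfl⟩ := Nat.exists_eq_succ_of_ne_zero hn
    simp [avoid]

/-- One transition shifts the visits of an excursion by one unit of time. Away from `α` nothing is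
lost, since time `0` contributes nothing there; at `α` the shifted mass is the return probability
`1`, which replaces the visit at time `0`. -/
theorem occupation_invariant {α : S} (h : ∑' n, firstReturn κ α n = 1) (y : S) :
    ∑' z, occupation κ α z * κ z y = occupation κ α y := by
  have h1 : ∑' z, occupation κ α z * κ z y = ∑' n, ∑' z, avoid κ α n z * κ z y := by
    simp only [occupation, ← ENNReal.tsum_mul_right]
    exact ENNReal.tsum_comm
  rw [h1]
  by_cases hy : y = α
  · subst hy
    rw [occupation_self]
    exact h
  · have h0 : avoid κ α 0 y = 0 := by simp [avoid, hy]
    rw [occupation, tsum_eq_zero_add' (f := fun n => avoid κ α n y) ENNReal.summable, h0, zero_add]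
    exact tsum_congr fun n => by rw [avoid, if_neg hy]

theorem avoid_eq_zero {𝒳 : Set S} (hc : IsClosedSet κ 𝒳) {α : S} (hα : α ∈ 𝒳) (n : ℕ) :
    ∀ y ∉ 𝒳, avoid κ α n y = 0 := by
  induction n with
  | zero =>
    intro y hy
    have : y ≠ α := fun h => hy (h ▸ hα)
    simp [avoid, this]
  | succ n ih =>
    intro y hy
    rw [avoid]
    split_ifs
    · rfl
    refine ENNReal.tsum_eq_zero.2 fun z => ?_
    by_cases hz : z ∈ 𝒳
    · have : κ z y = 0 := by
        by_contra h0
        exact hy (hc z hz ((PMF.mem_support_iff _ _).2 h0))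
      rw [this, mul_zero]
    · rw [ih z hz, zero_mul]

theorem IsPositiveRecurrent.exists_isStationary {𝒳 : Set S} (h : IsPositiveRecurrent κ 𝒳) :
    ∃ μ, IsStationary κ 𝒳 μ := by
  obtain ⟨⟨α, hα⟩, hc, hr⟩ := h
  obtain ⟨h1, h2⟩ := hr α hα
  have hsum := tsum_occupation h1
  have h0 : ∑' y, occupation κ α y ≠ 0 := by
    intro h0
    have := ENNReal.tsum_eq_zero.1 h0 α
    simp [occupation_self] at this
  have htop : ∑' y, occupation κ α y ≠ ∞ := hsum ▸ h2.ne
  refine ⟨PMF.normalize (occupation κ α) h0 htop, ?_, ?_⟩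
  · intro y hy
    rw [PMF.mem_support_normalize_iff] at hy
    by_contra hy'
    exact hy (ENNReal.tsum_eq_zero.2 fun n => avoid_eq_zero hc hα n y hy')
  · ext y
    simp only [PMF.bind_apply, PMF.normalize_apply]
    simp only [mul_right_comm (occupation κ α _) _ (κ _ y), ENNReal.tsum_mul_right]
    rw [occupation_invariant h1]

theorem IsStationary.expect_eq {𝒳 : Set S} {μ : PMF S} (h : IsStationary κ 𝒳 μ)
    (f : S → ℝ≥0∞) : (expect μ fun α => expect (κ α) f) = expect μ f := by
  rw [← expect_bind, h.2]

end Stationary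

end ScheduledAccess

namespace ScheduledAccess

/-! ### Marginals and means of the arrival counts -/

section Arrivals

variable {L J : ℕ} {Z : Type*}

open MeasureTheory in
-- Independence recast as a product measure, so that coordinate projections are measure preserving
-- and yield the marginals.
theorem Arrivals.toMeasure_counts (A : Arrivals L J Z) :
    (A.batch.map batchCount).toMeasure =
      Measure.pi fun l => Measure.pi fun j => (A.p l j).toMeasure := by
  refine Measure.ext_of_singleton fun n => ?_
  rw [PMF.toMeasure_apply_singleton _ _ (measurableSet_singleton n), A.law_counts,
    Measure.pi_singleton]
  refine Finset.prod_congr rfl fun l _ => ?_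
  rw [Measure.pi_singleton]
  exact Finset.prod_congr rfl fun j _ =>
    (PMF.toMeasure_apply_singleton _ _ (measurableSet_singleton _)).symm

open MeasureTheory in
theorem lintegral_toMeasure {S : Type*} [MeasurableSpace S] [MeasurableSingletonClass S]
    [Countable S] (p : PMF S) (f : S → ℝ≥0∞) : ∫⁻ a, f a ∂p.toMeasure = expect p f := by
  rw [lintegral_countable']
  refine tsum_congr fun a => ?_
  rw [PMF.toMeasure_apply_singleton _ _ (measurableSet_singleton a), mul_comm]

open MeasureTheory in
theorem Arrivals.expect_batchCount (A : Arrivals L J Z) (l : Fin L) (j : Fin J) :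
    (expect A.batch fun b => (batchCount b l j : ℝ≥0∞)) = expect (A.p l j) fun k => (k : ℝ≥0∞) := by
  rw [← expect_map A.batch batchCount fun n => (n l j : ℝ≥0∞), ← lintegral_toMeasure,
    A.toMeasure_counts, ← lintegral_toMeasure,
    ← (measurePreserving_eval (fun j => (A.p l j).toMeasure) j).lintegral_comp
      measurable_from_top]
  exact (measurePreserving_eval (fun l => Measure.pi fun j => (A.p l j).toMeasure) l).lintegral_comp
    (f := fun n : Fin J → ℕ => (n j : ℝ≥0∞)) (measurable_from_top.comp (measurable_pi_apply j))

/-- No summability is needed: an infinite mean gives `0` on both sides. -/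
theorem Arrivals.mean_eq (A : Arrivals L J Z) (l : Fin L) (j : Fin J) :
    A.mean l j = (expect (A.p l j) fun k => (k : ℝ≥0∞)).toReal := by
  rw [expect, ENNReal.tsum_toReal_eq fun k =>
    ENNReal.mul_ne_top (PMF.apply_ne_top _ _) (ENNReal.natCast_ne_top k)]
  simp [Arrivals.mean]

end Arrivals

/-! ### The balance of unfinished work -/

section Balance

variable {L J : ℕ} {Z : Type*}

theorem Channel.φ_nonneg (ch : Channel L J) (j : Fin J) (s : Schedule L J) : 0 ≤ ch.φ j s := by
  unfold Channel.φ
  split_ifs with h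
  -- Some message of power class `j` is transmitted, so subtracting `P_j` from the total power
  -- leaves nonnegative interference.
  · have hP : ch.P j ≤ ∑ l', ∑ j', (s l' j' : ℝ) * ch.P j' := by
      obtain ⟨l, -, hl⟩ := Finset.exists_ne_zero_of_sum_ne_zero h.ne'
      have h1 : (1 : ℝ) ≤ s l j := by exact_mod_cast Nat.one_le_iff_ne_zero.2 hl
      have hnn : ∀ l' j', 0 ≤ (s l' j' : ℝ) * ch.P j' := fun l' j' =>
        mul_nonneg (Nat.cast_nonneg _) (ch.P_pos j').le
      calc ch.P j ≤ (s l j : ℝ) * ch.P j := le_mul_of_one_le_left (ch.P_pos j).le h1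
        _ ≤ ∑ j', (s l j' : ℝ) * ch.P j' :=
          Finset.single_le_sum (f := fun j' => (s l j' : ℝ) * ch.P j')
            (fun j' _ => hnn l j') (Finset.mem_univ j)
        _ ≤ _ := Finset.single_le_sum (f := fun l' => ∑ j', (s l' j' : ℝ) * ch.P j')
            (fun l' _ => Finset.sum_nonneg fun j' _ => hnn l' j') (Finset.mem_univ l)
    have hv : 0 ≤ ch.N₀ * ch.W + (∑ l', ∑ j', (s l' j' : ℝ) * ch.P j' - ch.P j) :=
      add_nonneg (mul_pos ch.N₀_pos ch.W_pos).le (sub_nonneg.2 hP)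
    have hρ := ch.ρ_pos
    refine mul_nonneg hρ.le (Real.log_nonneg (le_add_of_nonneg_right ?_))
    exact div_nonneg (ch.P_pos j).le (mul_nonneg (by linarith) hv)
  · exact le_rfl

/-- The contribution of a message to the unfinished work of class `(l, j)`. -/
noncomputable def messageWork (l : Fin L) (j : Fin J) (m : Message L J Z) : ℝ≥0∞ :=
  if m.l = l ∧ m.j = j then ENNReal.ofReal m.residual else 0

/-- The unfinished work of class `(l, j)` in a state. -/
noncomputable def work (l : Fin L) (j : Fin J) (α : State L J Z) : ℝ≥0∞ :=
  (α.map (messageWork l j)).sum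

theorem work_append (l : Fin L) (j : Fin J) (α β : State L J Z) :
    work l j (α ++ β) = work l j α + work l j β := by
  simp [work]

theorem work_le {ch : Channel L J} {α : State L J Z} (hα : α ∈ validStates ch Z)
    (l : Fin L) (j : Fin J) : work l j α ≤ ENNReal.ofReal (ch.req l) * α.length := by
  have h : ∀ x ∈ α.map (messageWork l j), x ≤ ENNReal.ofReal (ch.req l) := by
    intro x hx
    obtain ⟨m, hm, rfl⟩ := List.mem_map.1 hx
    unfold messageWork
    split_ifs with hc
    · exact ENNReal.ofReal_le_ofReal (hc.1 ▸ (hα m hm).2)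
    · exact zero_le
  simpa [work, nsmul_eq_mul, mul_comm] using List.sum_le_card_nsmul _ _ h

theorem work_map_newMessage (ch : Channel L J) (b : List (Fin L × Fin J × Z))
    (l : Fin L) (j : Fin J) :
    work l j (b.map (newMessage ch)) = ENNReal.ofReal (ch.req l) * batchCount b l j := by
  induction b with
  | nil => simp [work, batchCount]
  | cons c b ih =>
    simp only [work, batchCount, List.map_cons, List.sum_cons, List.countP_cons] at ih ⊢
    rw [ih]
    by_cases h : c.1 = l ∧ c.2.1 = j
    · simp [messageWork, newMessage, h, mul_add, add_comm]
    · simp [messageWork, newMessage, h]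

/-- `ENNReal.ofReal` truncates at `0`, so a message that overshoots its requirement already counts
as zero work. -/
theorem work_filter_residual_pos (l : Fin L) (j : Fin J) (α : State L J Z)
    [DecidablePred fun m : Message L J Z => 0 < m.residual] :
    work l j (α.filter fun m => 0 < m.residual) = work l j α := by
  induction α with
  | nil => rfl
  | cons m α ih =>
    simp only [work] at ih ⊢
    by_cases h : 0 < m.residual
    · simp [h, ih]
    · have h0 : messageWork l j m = 0 := by
        simp [messageWork, ENNReal.ofReal_of_nonpos (not_lt.1 h)]
      simp [h, ih, h0]

theorem work_eq_sum (l : Fin L) (j : Fin J) (α : State L J Z) :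
    work l j α = ∑ k, messageWork l j (α.get k) := by
  simp [work]

/-- In one slot the unfinished work of class `(l, j)` drops by at most the quanta which the
transmitted messages of the class receive. -/
theorem work_le_work_serve_add (ch : Channel L J) (α : State L J Z) (T : Finset (Fin α.length))
    (l : Fin L) (j : Fin J) :
    work l j α ≤ work l j (serve ch α T) +
      scheduleOf α T l j * ENNReal.ofReal (ch.φ j (scheduleOf α T)) := by
  classical
  have hs : work l j (serve ch α T) = ∑ k, messageWork l j
      { α.get k with
        residual := (α.get k).residual -
          if k ∈ T then ch.φ (α.get k).j (scheduleOf α T) else 0 } := by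
    unfold serve
    rw [work_filter_residual_pos, work, List.map_map, ← List.ofFn_eq_map, List.sum_ofFn]
    rfl
  have hq : (scheduleOf α T l j : ℝ≥0∞) * ENNReal.ofReal (ch.φ j (scheduleOf α T)) =
      ∑ k, if k ∈ T ∧ (α.get k).l = l ∧ (α.get k).j = j then
        ENNReal.ofReal (ch.φ j (scheduleOf α T)) else 0 := by
    rw [← Finset.sum_filter, Finset.sum_const, nsmul_eq_mul]
    congr 2
    unfold scheduleOf
    congr 1
    ext k
    simp
  rw [hs, hq, work_eq_sum, ← Finset.sum_add_distrib]
  refine Finset.sum_le_sum fun k _ => ?_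
  by_cases hc : (α.get k).l = l ∧ (α.get k).j = j
  · by_cases hk : k ∈ T
    · simp only [messageWork, hc, hk, and_self, if_true]
      -- Subadditivity of the positive part, applied to `x = (x - φ) + φ`; it is strict when the
      -- quantum exceeds the residual.
      refine le_trans (ENNReal.ofReal_le_ofReal ?_) ENNReal.ofReal_add_le
      linarith
    · simp only [messageWork, hc, hk, and_self, if_true, if_false, false_and, sub_zero, add_zero,
        le_refl]
  · simp only [messageWork, hc, if_false, zero_le]

variable {K : ℕ}

theorem scheduleOf_mem_schedules (α : State L J Z) {T : Finset (Fin α.length)}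
    (hT : T.card ≤ K) : scheduleOf α T ∈ schedules L J K := by
  classical
  rw [mem_schedules]
  refine le_trans (le_of_eq ?_) hT
  rw [← Finset.sum_product', Finset.univ_product_univ,
    -- The schedule counts the fibres of `T` over the classes, so its entries sum to `T.card`.
    Finset.card_eq_sum_card_fiberwise (f := fun k => ((α.get k).l, (α.get k).j))
      (t := Finset.univ) (fun _ _ => Finset.mem_coe.2 (Finset.mem_univ _))]
  refine Finset.sum_congr rfl fun c _ => ?_
  unfold scheduleOf
  congr 1
  ext k
  simp [Prod.ext_iff]

/-- The law of the realized schedule when the state has law `μ`. -/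
noncomputable def scheduleLaw (ω : Policy L J Z K) (μ : PMF (State L J Z)) :
    PMF (Schedule L J) :=
  μ.bind fun α => (ω.choose α).map (scheduleOf α)

theorem support_scheduleLaw_subset (ω : Policy L J Z K) (μ : PMF (State L J Z)) :
    (scheduleLaw ω μ).support ⊆ schedules L J K := by
  intro s hs
  simp only [scheduleLaw, PMF.mem_support_bind_iff, PMF.mem_support_map_iff] at hs
  obtain ⟨α, -, T, hT, rfl⟩ := hs
  exact scheduleOf_mem_schedules α (ω.card_le α T hT)

theorem expect_scheduleLaw_eq_sum (ω : Policy L J Z K) (μ : PMF (State L J Z))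
    (f : Schedule L J → ℝ≥0∞) :
    expect (scheduleLaw ω μ) f = ∑ s ∈ schedules L J K, scheduleLaw ω μ s * f s := by
  refine tsum_eq_sum fun s hs => ?_
  have : scheduleLaw ω μ s = 0 := by
    by_contra h
    exact hs (support_scheduleLaw_subset ω μ ((PMF.mem_support_iff _ _).2 h))
  rw [this, zero_mul]

theorem scheduleLaw_mem_scheduleMeasures (ω : Policy L J Z K) (μ : PMF (State L J Z)) :
    (fun s => (scheduleLaw ω μ s).toReal) ∈ Channel.scheduleMeasures L J K := by
  refine ⟨fun s _ => ENNReal.toReal_nonneg, ?_⟩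
  rw [← ENNReal.toReal_sum fun s _ => PMF.apply_ne_top _ _]
  have h := expect_scheduleLaw_eq_sum ω μ fun _ => 1
  simp only [expect_const, mul_one] at h
  rw [← h, ENNReal.toReal_one]

/-- The work drift inequality in a given state. -/
theorem work_add_arrivals_le (ch : Channel L J) (A : Arrivals L J Z) (ω : Policy L J Z K)
    (α : State L J Z) (l : Fin L) (j : Fin J) :
    work l j α + ENNReal.ofReal (ch.req l) * expect (A.p l j) (fun k => (k : ℝ≥0∞)) ≤
      expect (transition ch A ω α) (work l j) +
        expect ((ω.choose α).map (scheduleOf α))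
          (fun s => s l j * ENNReal.ofReal (ch.φ j s)) := by
  have hA : ∀ T, expect (A.batch.map fun b => serve ch α T ++ b.map (newMessage ch)) (work l j) =
      work l j (serve ch α T) +
        ENNReal.ofReal (ch.req l) * expect (A.p l j) (fun k => (k : ℝ≥0∞)) := by
    intro T
    simp only [expect_map, work_append, work_map_newMessage, expect_add, expect_const,
      expect_const_mul, A.expect_batchCount]
  rw [transition, expect_bind]
  simp only [hA]
  rw [expect_map, expect_add, expect_const, add_right_comm, ← expect_add]
  gcongr
  rw [← expect_const (ω.choose α) (work l j α)]
  exact expect_mono _ fun T _ => work_le_work_serve_add ch α T l j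

/-- Averaging the one-slot drift over `μ` puts the same mean work on both sides; the finite mean
number of messages makes it finite, hence cancellable in `ℝ≥0∞`. -/
theorem IsStationary.req_mul_mean_le {ch : Channel L J} {A : Arrivals L J Z}
    {ω : Policy L J Z K} {𝒳 : Set (State L J Z)} {μ : PMF (State L J Z)}
    (hμ : IsStationary (transition ch A ω) 𝒳 μ) (h_valid : 𝒳 ⊆ validStates ch Z)
    (h_mean : ∑' α, μ α * (α.length : ℝ≥0∞) < ∞) (l : Fin L) (j : Fin J) :
    ENNReal.ofReal (ch.req l) * expect (A.p l j) (fun k => (k : ℝ≥0∞)) ≤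
      expect (scheduleLaw ω μ) fun s => s l j * ENNReal.ofReal (ch.φ j s) := by
  have hfin : expect μ (work l j) ≠ ∞ := by
    refine ne_top_of_le_ne_top ?_ (expect_mono μ fun α hα => work_le (h_valid (hμ.1 hα)) l j)
    rw [expect_const_mul]
    exact ENNReal.mul_ne_top ENNReal.ofReal_ne_top h_mean.ne
  have h := expect_mono μ fun α _ => work_add_arrivals_le ch A ω α l j
  rw [expect_add, expect_const, expect_add, hμ.expect_eq] at h
  rw [scheduleLaw, expect_bind]
  exact (ENNReal.add_le_add_iff_left hfin).1 h

end Balance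

end ScheduledAccess

theorem mainTheorem6 {L J K : ℕ} {Z : Type*}
    (ch : ScheduledAccess.Channel L J)
    (A : ScheduledAccess.Arrivals L J Z)
    (ω : ScheduledAccess.Policy L J Z K)
    (𝒳 : Set (ScheduledAccess.State L J Z))
    (h_valid : 𝒳 ⊆ ScheduledAccess.validStates ch Z)
    (h_rec : ScheduledAccess.IsPositiveRecurrent (ScheduledAccess.transition ch A ω) 𝒳)
    (h_mean : ScheduledAccess.HasFiniteStationaryMean
      (ScheduledAccess.transition ch A ω) 𝒳 (fun α => α.length)) :
    A.mean ∈ ch.outerRegion K := by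
  obtain ⟨μ, hμ⟩ := h_rec.exists_isStationary
  refine Set.mem_biUnion (ScheduledAccess.scheduleLaw_mem_scheduleMeasures ω μ) fun l j => ?_
  have hreq : 0 < ch.req l := ch.req_pos l
  rw [A.mean_eq]
  refine ⟨ENNReal.toReal_nonneg, ?_⟩
  have h := hμ.req_mul_mean_le h_valid (h_mean μ hμ) l j
  rw [ScheduledAccess.expect_scheduleLaw_eq_sum] at h
  have hne : ∀ s ∈ ScheduledAccess.schedules L J K, ScheduledAccess.scheduleLaw ω μ s *
      ((s l j : ℝ≥0∞) * ENNReal.ofReal (ch.φ j s)) ≠ ∞ := fun s _ =>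
    ENNReal.mul_ne_top (PMF.apply_ne_top _ _)
      (ENNReal.mul_ne_top (ENNReal.natCast_ne_top _) ENNReal.ofReal_ne_top)
  -- Passing to reals requires a finite right side, which holds because only the finitely many
  -- schedules of `S_K` occur.
  have h' := ENNReal.toReal_mono (ENNReal.sum_ne_top.2 hne) h
  rw [ENNReal.toReal_mul, ENNReal.toReal_ofReal hreq.le, ENNReal.toReal_sum hne] at h'
  -- The restriction to `s_{lj} > 0` costs nothing: the other terms carry the factor `s_{lj} = 0`.
  rw [ScheduledAccess.Channel.Ψ, Finset.sum_filter_of_ne]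
  · rw [← mul_le_mul_iff_right₀ hreq, Finset.mul_sum]
    refine h'.trans (le_of_eq (Finset.sum_congr rfl fun s _ => ?_))
    rw [ENNReal.toReal_mul, ENNReal.toReal_mul, ENNReal.toReal_natCast,
      ENNReal.toReal_ofReal (ch.φ_nonneg j s)]
    field_simp
  · intro s _ hs
    refine Nat.pos_of_ne_zero fun h0 => hs ?_
    simp [h0]
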